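/- Let $X$ and $E$ be finite-dimensional complex vector spaces of the same dimension $u$ (for instance $E=X$), equipped with arbitrary positive definite Hermitian forms $G_2$ (on $X$) and $G_1$ (on $E$), and let singular values of linear maps $X\to E$ be taken with respect to these forms: $\sigma_1[T]\ge\dots\ge\sigma_u[T]\ge 0$ are the square roots of the eigenvalues of $T^*T$, listed with multiplicity. Let $K,B:X\to E$ be linear with $B$ invertible, put $T(z)=K-zB$ for $z\in\mathbb{C}$, let $\lambda_i$ be an eigenvalue of $B^{-1}K:X\to X$, let $\theta\in\mathbb{R}$ be fixed, and let $l\ge 1$ be an integer. Then the following are equivalent: 1. $T(\lambda_i+\varepsilon e^{i\theta})$ has a singular value of exact order $|\varepsilon|^l$, that is, for some $j\in\{1,\dots,u\}$ there are constants $c,C,\delta>0$ such that $c|\varepsilon|^l\le\sigma_j[T(\lambda_i+\varepsilon e^{i\theta})]\le C|\varepsilon|^l$ for all real $\varepsilon$ with $|\varepsilon|<\delta$. 2. $B^{-1}K$ has, in its Jordan decomposition, a Jordan block of size exactly $l\times l$ with eigenvalue $\lambda_i$. -/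

import Mathlib

open scoped Topology Asymptotics

/-- The square pencil `T(z) = K - z B`, for linear maps `K, B : X → E`. -/
def pencil {X E : Type*} [AddCommGroup X] [Module ℂ X] [AddCommGroup E] [Module ℂ E]
    (K B : X →ₗ[ℂ] E) (z : ℂ) : X →ₗ[ℂ] E :=
  K - z • B

/-- The `l × l` Jordan block with eigenvalue `μ`: `μ` on the diagonal, `1` on the superdiagonal
and `0` elsewhere. -/
def jordanBlock (l : ℕ) (μ : ℂ) : Matrix (Fin l) (Fin l) ℂ :=
  Matrix.of fun i j => if i = j then μ else if (i : ℕ) + 1 = (j : ℕ) then 1 else 0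

/-- A Jordan decomposition of an endomorphism `A`: a basis, split into finitely many nonempty
groups, in which the matrix of `A` is block diagonal with a Jordan block for each group. -/
structure JordanDecomposition {X : Type*} [AddCommGroup X] [Module ℂ X] (A : X →ₗ[ℂ] X) where
  /-- the number of blocks -/
  numBlocks : ℕ
  /-- the size of each block -/
  size : Fin numBlocks → ℕ
  size_pos : ∀ k, 0 < size k
  /-- the eigenvalue of each block -/
  eigenvalue : Fin numBlocks → ℂ
  /-- the Jordan basis -/
  basis : Module.Basis (Σ k : Fin numBlocks, Fin (size k)) ℂ X
  toMatrix_eq : LinearMap.toMatrix basis basis A =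
    Matrix.blockDiagonal' fun k => jordanBlock (size k) (eigenvalue k)

/-- `A` has an `l × l` Jordan block with eigenvalue `μ` in its Jordan decomposition. -/
def HasJordanBlock {X : Type*} [AddCommGroup X] [Module ℂ X] (A : X →ₗ[ℂ] X)
    (l : ℕ) (μ : ℂ) : Prop :=
  ∃ D : JordanDecomposition A, ∃ k : Fin D.numBlocks, D.size k = l ∧ D.eigenvalue k = μ

/-! Put A = B⁻¹K, so that T(λ + w) = B(A - (λ + w)), and take a Jordan basis of A. In a λ-block with
string v₀, …, v_{m-1}, replace v₀ by ∑ wⁱ vᵢ: a telescoping sum gives A - (λ + w) of it as -w^m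
v_{m-1}. Keep all other basis vectors. Then T(λ + w) sends input vectors p_x(w) to w^{d_x} q_x(w),
where p(0) and q(0) are bases and d_x is m for the replaced vector of a λ-block of size m, and 0
elsewhere (`map_inputVec`, `linearIndependent_outputVec_zero`).

Bases that stay uniformly nondegenerate cost only constant factors, so by min-max the singular
values are of orders |w|^{d_x}, the d_x taken in increasing order
(`singularValues_isTheta_norm_pow`). As different powers have different orders and l ≥ 1 discards
the zero exponents, the orders that occur are exactly the sizes of the λ-blocks. -/

theorem LinearIndependent.finrank_span_image {𝕜 V ι : Type*} [Field 𝕜] [AddCommGroup V] [Module 𝕜 V]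
    {v : ι → V} (hv : LinearIndependent 𝕜 v) (s : Finset ι) :
    Module.finrank 𝕜 (Submodule.span 𝕜 (v '' s)) = s.card := by
  have h := finrank_span_eq_card (hv.comp ((↑) : s → ι) Subtype.val_injective)
  rw [Set.range_comp, Subtype.range_coe_subtype] at h
  simpa using h

/-! ### Min-max bounds for singular values. -/

section SingularValueBounds

variable {𝕜 X E : Type*} [RCLike 𝕜]
  [NormedAddCommGroup X] [InnerProductSpace 𝕜 X] [FiniteDimensional 𝕜 X]
  [NormedAddCommGroup E] [InnerProductSpace 𝕜 E] [FiniteDimensional 𝕜 E]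

theorem LinearMap.norm_sq_apply_eq_sum_singularValues (T : X →ₗ[𝕜] E) (x : X) :
    ‖T x‖ ^ 2 = ∑ i : Fin (Module.finrank 𝕜 X), T.singularValues i ^ 2 *
      ‖(T.isSymmetric_adjoint_comp_self.eigenvectorBasis rfl).repr x i‖ ^ 2 := by
  set hS := T.isSymmetric_adjoint_comp_self
  have h1 : ((‖T x‖ ^ 2 : ℝ) : 𝕜) = inner 𝕜 x ((T.adjoint ∘ₗ T) x) := by
    rw [LinearMap.comp_apply, LinearMap.adjoint_inner_right, inner_self_eq_norm_sq_to_K]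
    push_cast; rfl
  rw [← (hS.eigenvectorBasis rfl).repr.inner_map_map, PiLp.inner_apply] at h1
  apply RCLike.ofReal_injective (K := 𝕜)
  rw [h1]
  push_cast
  refine Finset.sum_congr rfl fun i _ => ?_
  have happ := hS.eigenvectorBasis_apply_self_apply rfl x i
  rw [LinearMap.coe_comp] at happ
  rw [happ, ← T.sq_singularValues_fin rfl i, RCLike.inner_apply,
    mul_assoc, RCLike.mul_conj]
  push_cast
  rfl

omit [FiniteDimensional 𝕜 X] in
theorem OrthonormalBasis.repr_eq_zero_of_mem_span_image {ι : Type*} [Fintype ι]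
    (b : OrthonormalBasis ι 𝕜 X) {s : Set ι} {x : X} (hx : x ∈ Submodule.span 𝕜 (b '' s))
    {i : ι} (hi : i ∉ s) : b.repr x i = 0 := by
  classical
  induction hx using Submodule.span_induction with
  | mem x h =>
    obtain ⟨j, hj, rfl⟩ := h
    have : i ≠ j := by rintro rfl; exact hi hj
    simp [b.repr_self, this]
  | zero => simp
  | add x y _ _ hx hy => simp [hx, hy]
  | smul a x _ hx => simp [hx]

theorem Submodule.exists_ne_zero_mem_of_finrank_lt {V W : Submodule 𝕜 X}
    (h : Module.finrank 𝕜 X < Module.finrank 𝕜 V + Module.finrank 𝕜 W) :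
    ∃ x ∈ V, x ∈ W ∧ x ≠ 0 := by
  by_contra! H
  have hd : Disjoint V W := Submodule.disjoint_def.2 fun x hx hy => H x hx hy
  exact absurd (Submodule.finrank_add_finrank_le_of_disjoint hd) (by omega)

/-- Courant–Fischer: by dimension count, `V` meets the span of the right singular vectors of index
at least `j`, where `T` stretches by at most the `j`-th singular value (counted from 0). -/
theorem LinearMap.le_singularValues_of_le_norm (T : X →ₗ[𝕜] E) {j : ℕ} {c : ℝ}
    (V : Submodule 𝕜 X) (hV : j < Module.finrank 𝕜 V) (h : ∀ x ∈ V, c * ‖x‖ ≤ ‖T x‖) :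
    c ≤ T.singularValues j := by
  have hj : j < Module.finrank 𝕜 X := hV.trans_le (Submodule.finrank_le V)
  set b := T.isSymmetric_adjoint_comp_self.eigenvectorBasis rfl with hb
  let s : Finset (Fin (Module.finrank 𝕜 X)) := Finset.Ici ⟨j, hj⟩
  have hs : s.card = Module.finrank 𝕜 X - j := by simp [s]
  obtain ⟨x, hxV, hxW, hx0⟩ := Submodule.exists_ne_zero_mem_of_finrank_lt (V := V)
    (W := Submodule.span 𝕜 (b '' s)) (by rw [b.orthonormal.linearIndependent.finrank_span_image, hs]; omega)
  have hle : ‖T x‖ ^ 2 ≤ (T.singularValues j * ‖x‖) ^ 2 := by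
    rw [T.norm_sq_apply_eq_sum_singularValues, mul_pow, ← b.repr.norm_map x,
      EuclideanSpace.norm_sq_eq, Finset.mul_sum]
    refine Finset.sum_le_sum fun i _ => ?_
    by_cases hi : i ∈ s
    · have : j ≤ i := by simpa [s, Fin.le_def] using hi
      gcongr
      · exact T.singularValues_nonneg _
      · exact T.singularValues_antitone this
    · rw [← hb, b.repr_eq_zero_of_mem_span_image hxW (by simpa using hi)]
      simp
  have h2 := abs_le_of_sq_le_sq hle (mul_nonneg (T.singularValues_nonneg _) (norm_nonneg _))
  exact le_of_mul_le_mul_right ((h x hxV).trans ((le_abs_self _).trans (by simpa using h2)))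
    (norm_pos_iff.2 hx0)

/-- The dual bound: `V` has codimension at most `j`, so it meets the span of the first `j + 1` right
singular vectors. -/
theorem LinearMap.singularValues_le_of_norm_le (T : X →ₗ[𝕜] E) {j : ℕ} {c : ℝ} (hc : 0 ≤ c)
    (V : Submodule 𝕜 X) (hV : Module.finrank 𝕜 X ≤ Module.finrank 𝕜 V + j)
    (h : ∀ x ∈ V, ‖T x‖ ≤ c * ‖x‖) :
    T.singularValues j ≤ c := by
  rcases le_or_gt (Module.finrank 𝕜 X) j with hj | hj
  · rwa [T.singularValues_of_finrank_le hj]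
  set b := T.isSymmetric_adjoint_comp_self.eigenvectorBasis rfl with hb
  let s : Finset (Fin (Module.finrank 𝕜 X)) := Finset.Iic ⟨j, hj⟩
  have hs : s.card = j + 1 := by simp [s]
  obtain ⟨x, hxV, hxW, hx0⟩ := Submodule.exists_ne_zero_mem_of_finrank_lt (V := V)
    (W := Submodule.span 𝕜 (b '' s)) (by rw [b.orthonormal.linearIndependent.finrank_span_image, hs]; omega)
  have hle : (T.singularValues j * ‖x‖) ^ 2 ≤ ‖T x‖ ^ 2 := by
    rw [T.norm_sq_apply_eq_sum_singularValues, mul_pow, ← b.repr.norm_map x,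
      EuclideanSpace.norm_sq_eq, Finset.mul_sum]
    refine Finset.sum_le_sum fun i _ => ?_
    by_cases hi : i ∈ s
    · have : i ≤ j := by simpa [s, Fin.le_def] using hi
      gcongr
      · exact T.singularValues_nonneg _
      · exact T.singularValues_antitone this
    · rw [← hb, b.repr_eq_zero_of_mem_span_image hxW (by simpa using hi)]
      simp
  have h2 := abs_le_of_sq_le_sq hle (norm_nonneg _)
  exact le_of_mul_le_mul_right ((le_abs_self _).trans (h2.trans (h x hxV)))
    (norm_pos_iff.2 hx0)

end SingularValueBounds

/-! ### Uniform norm estimates for continuously varying families of vectors. -/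

section PerturbedBases

variable {𝕜 X ι : Type*} [RCLike 𝕜] [NormedAddCommGroup X] [NormedSpace 𝕜 X]
  [Fintype ι]

theorem LinearIndependent.exists_pos_forall_sum_norm_le_eventually {p : 𝕜 → ι → X}
    (hp : ∀ i, ContinuousAt (fun w => p w i) 0) (h0 : LinearIndependent 𝕜 (p 0)) :
    ∃ c > 0, ∀ᶠ w in 𝓝 (0 : 𝕜), ∀ a : ι → 𝕜, c * ∑ i, ‖a i‖ ≤ ‖∑ i, a i • p w i‖ := by
  obtain ⟨K, hK, hanti⟩ := (Fintype.linearCombination 𝕜 (p 0)).exists_antilipschitzWith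
    (by rw [LinearMap.ker_eq_bot]; exact h0.fintypeLinearCombination_injective)
  have hbound : ∀ a : ι → 𝕜, ∑ i, ‖a i‖ ≤ (Fintype.card ι * K : ℝ) * ‖∑ i, a i • p 0 i‖ := by
    intro a
    have h1 : ‖a‖ ≤ K * ‖∑ i, a i • p 0 i‖ := by
      simpa [Fintype.linearCombination_apply] using hanti.le_mul_norm (by simp) a
    calc ∑ i, ‖a i‖ ≤ ∑ i : ι, ‖a‖ := Finset.sum_le_sum fun i _ => norm_le_pi_norm a i
      _ = Fintype.card ι * ‖a‖ := by simp
      _ ≤ _ := by rw [mul_assoc]; gcongr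
  -- The `+ 1` keeps `M` positive even for an empty index type; half of the bound `1 / M` at `w = 0`
  -- is then given up to the perturbation.
  set M : ℝ := Fintype.card ι * K + 1 with hM
  have hMpos : 0 < M := by positivity
  refine ⟨1 / M / 2, by positivity, ?_⟩
  have hev : ∀ᶠ w in 𝓝 (0 : 𝕜), ∀ i, ‖p w i - p 0 i‖ < 1 / M / 2 := by
    rw [Filter.eventually_all]
    intro i
    have := Metric.continuousAt_iff'.1 (hp i) (1 / M / 2) (by positivity)
    simpa [dist_eq_norm] using this
  filter_upwards [hev] with w hw a
  have h1 : 1 / M * ∑ i, ‖a i‖ ≤ ‖∑ i, a i • p 0 i‖ := by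
    rw [one_div, inv_mul_le_iff₀ hMpos]
    refine (hbound a).trans ?_
    gcongr
    linarith
  have h2 : ‖∑ i, a i • p w i - ∑ i, a i • p 0 i‖ ≤ 1 / M / 2 * ∑ i, ‖a i‖ := by
    rw [← Finset.sum_sub_distrib, Finset.mul_sum]
    refine (norm_sum_le _ _).trans (Finset.sum_le_sum fun i _ => ?_)
    rw [← smul_sub, norm_smul, mul_comm]
    exact mul_le_mul_of_nonneg_right (hw i).le (norm_nonneg _)
  have h3 := norm_sub_norm_le (∑ i, a i • p 0 i) (∑ i, a i • p w i)
  rw [norm_sub_rev] at h3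
  linarith

theorem exists_pos_forall_norm_sum_smul_le_eventually {p : 𝕜 → ι → X}
    (hp : ∀ i, ContinuousAt (fun w => p w i) 0) :
    ∃ C > 0, ∀ᶠ w in 𝓝 (0 : 𝕜), ∀ a : ι → 𝕜, ‖∑ i, a i • p w i‖ ≤ C * ∑ i, ‖a i‖ := by
  refine ⟨∑ i, ‖p 0 i‖ + 1, by positivity, ?_⟩
  have hev : ∀ᶠ w in 𝓝 (0 : 𝕜), ∀ i, ‖p w i‖ < ‖p 0 i‖ + 1 := by
    rw [Filter.eventually_all]
    intro i
    exact (hp i).norm.eventually_lt_const (by simp)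
  filter_upwards [hev] with w hw a
  rw [Finset.mul_sum]
  refine (norm_sum_le _ _).trans (Finset.sum_le_sum fun i _ => ?_)
  rw [norm_smul, mul_comm]
  refine mul_le_mul_of_nonneg_right ((hw i).le.trans ?_) (norm_nonneg _)
  have := Finset.single_le_sum (f := fun i => ‖p 0 i‖) (fun i _ => norm_nonneg _)
    (Finset.mem_univ i)
  simpa using this

end PerturbedBases

/-! ### Orders of the singular values of a diagonalised family. -/

section Asymptotics

variable {𝕜 X E ι : Type*} [RCLike 𝕜]
  [NormedAddCommGroup X] [InnerProductSpace 𝕜 X] [FiniteDimensional 𝕜 X]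
  [NormedAddCommGroup E] [InnerProductSpace 𝕜 E] [FiniteDimensional 𝕜 E] [Fintype ι]

theorem mem_span_image_iff_exists_fintype_sum {V : Type*} [AddCommGroup V] [Module 𝕜 V]
    (v : ι → V) (s : Set ι) {x : V} (hx : x ∈ Submodule.span 𝕜 (v '' s)) :
    ∃ a : ι → 𝕜, (∀ i ∉ s, a i = 0) ∧ ∑ i, a i • v i = x := by
  obtain ⟨l, hl, rfl⟩ := (Finsupp.mem_span_image_iff_linearCombination 𝕜).1 hx
  refine ⟨l, fun i hi => ?_, ?_⟩
  · by_contra h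
    exact hi (hl (by simpa using h))
  · rw [Finsupp.linearCombination_apply, Finsupp.sum_fintype _ _ (by simp)]

/-- If a linear map depending on a parameter `w` is brought to the form `diag (w ^ d i)` by
bases that stay bounded away from degeneracy as `w → 0`, then its singular values are of order
`‖w‖ ^ d i`. -/
theorem singularValues_isTheta_norm_pow (T : 𝕜 → X →ₗ[𝕜] E) (p : 𝕜 → ι → X) (q : 𝕜 → ι → E)
    (d : ι → ℕ) (hT : ∀ w i, T w (p w i) = w ^ d i • q w i)
    (hp : ∀ i, ContinuousAt (fun w => p w i) 0) (hq : ∀ i, ContinuousAt (fun w => q w i) 0)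
    (hp0 : LinearIndependent 𝕜 (p 0)) (hq0 : LinearIndependent 𝕜 (q 0))
    (hcard : Fintype.card ι = Module.finrank 𝕜 X) {j m : ℕ}
    (hj : (Finset.univ.filter fun i => d i < m).card ≤ j)
    (hj' : j < (Finset.univ.filter fun i => d i ≤ m).card) :
    (fun w => (T w).singularValues j) =Θ[𝓝 0] fun w => ‖w‖ ^ m := by
  classical
  obtain ⟨c₁, hc₁, h₁⟩ := hp0.exists_pos_forall_sum_norm_le_eventually hp
  obtain ⟨c₂, hc₂, h₂⟩ := hq0.exists_pos_forall_sum_norm_le_eventually hq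
  obtain ⟨C₁, hC₁, H₁⟩ := exists_pos_forall_norm_sum_smul_le_eventually hp
  obtain ⟨C₂, hC₂, H₂⟩ := exists_pos_forall_norm_sum_smul_le_eventually hq
  have hball : ∀ᶠ w in 𝓝 (0 : 𝕜), ‖w‖ ≤ 1 := by
    filter_upwards [Metric.closedBall_mem_nhds (0 : 𝕜) one_pos] with w hw
    simpa using hw
  have hTsum : ∀ w (a : ι → 𝕜), T w (∑ i, a i • p w i) = ∑ i, (a i * w ^ d i) • q w i := by
    intro w a
    simp [map_sum, hT, mul_smul]
  have hli : ∀ w, (∀ a : ι → 𝕜, c₁ * ∑ i, ‖a i‖ ≤ ‖∑ i, a i • p w i‖) →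
      LinearIndependent 𝕜 (p w) := by
    intro w hw
    rw [Fintype.linearIndependent_iff]
    intro a ha i
    have h := hw a
    rw [ha, norm_zero] at h
    have h' : ∑ i, ‖a i‖ ≤ 0 := nonpos_of_mul_nonpos_right h hc₁
    have := (Finset.single_le_sum (f := fun i => ‖a i‖) (fun i _ => norm_nonneg _)
      (Finset.mem_univ i)).trans h'
    simpa using this
  constructor
  -- Upper bound: test on the span of the `p w i` with `m ≤ d i`, of codimension at most `j`; there
  -- `‖w‖ ≤ 1` gives `‖w‖ ^ d i ≤ ‖w‖ ^ m`. The lower bound tests on those with `d i ≤ m`, of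
  -- dimension greater than `j`.
  · refine Asymptotics.IsBigO.of_bound (C₂ / c₁) ?_
    filter_upwards [h₁, H₂, hball] with w h₁ H₂ hw
    rw [Real.norm_of_nonneg ((T w).singularValues_nonneg j), Real.norm_of_nonneg (by positivity)]
    refine (T w).singularValues_le_of_norm_le (by positivity)
      (Submodule.span 𝕜 (p w '' (Finset.univ.filter fun i => m ≤ d i : Finset ι))) ?_ ?_
    · rw [(hli w h₁).finrank_span_image, ← hcard]
      have := Finset.card_filter_add_card_filter_not (s := (Finset.univ : Finset ι))
        (fun i => d i < m)
      simp only [not_lt] at this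
      rw [Finset.card_univ] at this
      omega
    · intro x hx
      obtain ⟨a, ha, rfl⟩ := mem_span_image_iff_exists_fintype_sum _ _ hx
      rw [hTsum]
      have hsum : ∑ i, ‖a i * w ^ d i‖ ≤ ‖w‖ ^ m * ∑ i, ‖a i‖ := by
        rw [Finset.mul_sum]
        refine Finset.sum_le_sum fun i _ => ?_
        rw [norm_mul, norm_pow, mul_comm]
        by_cases hi : m ≤ d i
        · exact mul_le_mul_of_nonneg_right (pow_le_pow_of_le_one (norm_nonneg _) hw hi)
            (norm_nonneg _)
        · simp [ha i (by simpa using hi)]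
      calc ‖∑ i, (a i * w ^ d i) • q w i‖ ≤ C₂ * ∑ i, ‖a i * w ^ d i‖ := H₂ _
        _ ≤ C₂ * (‖w‖ ^ m * ∑ i, ‖a i‖) := by gcongr
        _ = C₂ / c₁ * ‖w‖ ^ m * (c₁ * ∑ i, ‖a i‖) := by field_simp
        _ ≤ _ := by gcongr; exact h₁ a
  · refine Asymptotics.IsBigO.of_bound (C₁ / c₂) ?_
    filter_upwards [h₁, H₁, h₂, hball] with w h₁ H₁ h₂ hw
    rw [Real.norm_of_nonneg ((T w).singularValues_nonneg j), Real.norm_of_nonneg (by positivity)]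
    suffices h : c₂ / C₁ * ‖w‖ ^ m ≤ (T w).singularValues j by
      calc ‖w‖ ^ m = C₁ / c₂ * (c₂ / C₁ * ‖w‖ ^ m) := by field_simp
        _ ≤ _ := by gcongr
    refine (T w).le_singularValues_of_le_norm
      (Submodule.span 𝕜 (p w '' (Finset.univ.filter fun i => d i ≤ m : Finset ι))) ?_ ?_
    · rwa [(hli w h₁).finrank_span_image]
    · intro x hx
      obtain ⟨a, ha, rfl⟩ := mem_span_image_iff_exists_fintype_sum _ _ hx
      rw [hTsum]
      have hsum : ‖w‖ ^ m * ∑ i, ‖a i‖ ≤ ∑ i, ‖a i * w ^ d i‖ := by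
        rw [Finset.mul_sum]
        refine Finset.sum_le_sum fun i _ => ?_
        rw [norm_mul, norm_pow, mul_comm]
        by_cases hi : d i ≤ m
        · exact mul_le_mul_of_nonneg_left (pow_le_pow_of_le_one (norm_nonneg _) hw hi)
            (norm_nonneg _)
        · simp [ha i (by simpa using hi)]
      calc c₂ / C₁ * ‖w‖ ^ m * ‖∑ i, a i • p w i‖
          ≤ c₂ / C₁ * ‖w‖ ^ m * (C₁ * ∑ i, ‖a i‖) := by gcongr; exact H₁ a
        _ = c₂ * (‖w‖ ^ m * ∑ i, ‖a i‖) := by field_simp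
        _ ≤ c₂ * ∑ i, ‖a i * w ^ d i‖ := by gcongr
        _ ≤ _ := h₂ _

/-- `m` is the entry at position `j`, counted from 0, of the values of `d` sorted increasingly. -/
theorem exists_card_filter_lt_le_and_lt_card_filter_le (d : ι → ℕ) {j : ℕ}
    (hj : j < Fintype.card ι) :
    ∃ m, (Finset.univ.filter fun i => d i < m).card ≤ j ∧
      j < (Finset.univ.filter fun i => d i ≤ m).card := by
  classical
  have hex : ∃ m, j < (Finset.univ.filter fun i => d i ≤ m).card := by
    refine ⟨∑ i, d i, ?_⟩
    rw [Finset.filter_true_of_mem, Finset.card_univ]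
    · exact hj
    · intro i _
      exact Finset.single_le_sum (fun i _ => Nat.zero_le _) (Finset.mem_univ i)
  refine ⟨Nat.find hex, ?_, Nat.find_spec hex⟩
  rcases h : Nat.find hex with _ | m
  · simp
  · have := Nat.find_min hex (m := m) (by omega)
    simpa [Nat.lt_succ_iff] using this

theorem eq_of_norm_pow_isTheta_norm_pow {m l : ℕ}
    (h : (fun w : ℝ => ‖w‖ ^ m) =Θ[𝓝 0] fun w : ℝ => ‖w‖ ^ l) : m = l := by
  have key : ∀ {a b : ℕ}, a < b →
      ¬ (fun w : ℝ => ‖w‖ ^ a) =O[𝓝 0] fun w : ℝ => ‖w‖ ^ b := by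
    intro a b hab hO
    have ho : (fun w : ℝ => ‖w‖ ^ b) =o[𝓝 0] fun w : ℝ => ‖w‖ ^ a := by
      have := (Asymptotics.isLittleO_pow_pow (𝕜 := ℝ) hab).norm_norm
      simpa using this
    -- Away from `0` the power does not vanish, so it cannot be little-o of itself.
    have h0 := (ho.trans_isBigO hO).mono (nhdsWithin_le_nhds (s := {0}ᶜ))
    refine Asymptotics.isLittleO_irrefl' ?_ h0
    refine Filter.Eventually.frequently ?_
    filter_upwards [self_mem_nhdsWithin] with w hw
    have : w ≠ 0 := hw
    simp [this]
  rcases lt_trichotomy m l with h1 | h1 | h1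
  · exact (key h1 h.1).elim
  · exact h1
  · exact (key h1 h.2).elim

end Asymptotics

/-! ### Jordan decompositions in terms of strings of basis vectors. -/

section JordanBasis

variable {X : Type*} [AddCommGroup X] [Module ℂ X] {n : ℕ} {size : Fin n → ℕ}

theorem toLin_blockDiagonal'_jordanBlock_apply
    (b : Module.Basis (Σ k : Fin n, Fin (size k)) ℂ X) (μ : Fin n → ℂ)
    (k : Fin n) (j : Fin (size k)) :
    Matrix.toLin b b (Matrix.blockDiagonal' fun k => jordanBlock (size k) (μ k)) (b ⟨k, j⟩) =
      μ k • b ⟨k, j⟩ +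
        if _h : 0 < (j : ℕ) then b ⟨k, ⟨j - 1, (Nat.sub_le _ _).trans_lt j.2⟩⟩ else 0 := by
  classical
  rw [Matrix.toLin_self, Fintype.sum_sigma, Finset.sum_eq_single k]
  · simp only [Matrix.blockDiagonal'_apply_eq, jordanBlock, Matrix.of_apply]
    rw [← Finset.add_sum_erase _ _ (Finset.mem_univ j)]
    congr 1
    · simp
    split_ifs with h
    · rw [Finset.sum_eq_single ⟨j - 1, (Nat.sub_le _ _).trans_lt j.2⟩]
      · rw [if_neg (by rw [Fin.ext_iff]; simp only; omega), if_pos (by simp only; omega), one_smul]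
      · intro i hi hne
        rw [if_neg (Finset.ne_of_mem_erase hi), if_neg, zero_smul]
        rw [Ne, Fin.ext_iff] at hne
        simp only at hne
        omega
      · intro hn
        refine absurd (Finset.mem_erase.2 ⟨?_, Finset.mem_univ _⟩) hn
        rw [Ne, Fin.ext_iff]; simp only; omega
    · refine Finset.sum_eq_zero fun i hi => ?_
      rw [if_neg (Finset.ne_of_mem_erase hi), if_neg (by omega), zero_smul]
  · intro i _ hi
    refine Finset.sum_eq_zero fun a _ => ?_
    rw [Matrix.blockDiagonal'_apply_ne _ _ _ hi, zero_smul]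
  · simp

theorem JordanDecomposition.apply_basis {A : X →ₗ[ℂ] X} (D : JordanDecomposition A)
    (k : Fin D.numBlocks) (j : Fin (D.size k)) :
    A (D.basis ⟨k, j⟩) = D.eigenvalue k • D.basis ⟨k, j⟩ +
      if _h : 0 < (j : ℕ) then D.basis ⟨k, ⟨j - 1, (Nat.sub_le _ _).trans_lt j.2⟩⟩ else 0 := by
  rw [← toLin_blockDiagonal'_jordanBlock_apply, ← D.toMatrix_eq, Matrix.toLin_toMatrix]

/-- A basis indexed by finitely many strings, on each of which `A` acts as a Jordan block, gives
a Jordan decomposition; empty strings are discarded. -/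
theorem nonempty_jordanDecomposition_of_basis {ι : Type*} [Fintype ι] {e : ι → ℕ}
    (b : Module.Basis (Σ i, Fin (e i)) ℂ X) (μ : ι → ℂ) (A : X →ₗ[ℂ] X)
    (hA : ∀ i (j : Fin (e i)), A (b ⟨i, j⟩) = μ i • b ⟨i, j⟩ +
      if _h : 0 < (j : ℕ) then b ⟨i, ⟨j - 1, (Nat.sub_le _ _).trans_lt j.2⟩⟩ else 0) :
    Nonempty (JordanDecomposition A) := by
  classical
  let f := (Fintype.equivFin {i : ι // 0 < e i}).symm
  let g : (Σ k, Fin (e (f k))) → Σ i, Fin (e i) := fun x => ⟨f x.1, x.2⟩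
  have hg : Function.Bijective g := by
    constructor
    · rintro ⟨k, a⟩ ⟨k', a'⟩ h
      have hk : k = k' := f.injective (Subtype.ext (congrArg Sigma.fst h))
      subst hk
      simpa [g] using h
    · rintro ⟨i, a⟩
      have hi : 0 < e i := (Nat.zero_le _).trans_lt a.2
      obtain ⟨k, hk⟩ := f.surjective ⟨i, hi⟩
      have hk' : (f k : ι) = i := congrArg Subtype.val hk
      subst hk'
      exact ⟨⟨k, a⟩, rfl⟩
  let b' := b.reindex (Equiv.ofBijective g hg).symm
  have hb' : ∀ x, b' x = b (g x) := fun x => by simp [b']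
  refine ⟨⟨_, fun k => e (f k), fun k => (f k).2, fun k => μ (f k), b', ?_⟩⟩
  rw [← LinearMap.toMatrix_toLin b' b' (Matrix.blockDiagonal' _)]
  congr 1
  refine b'.ext fun ⟨k, j⟩ => ?_
  rw [toLin_blockDiagonal'_jordanBlock_apply]
  simp only [hb', g]
  exact hA _ _

end JordanBasis

/-! ### Existence of the Jordan decomposition. -/

section Existence

open Polynomial

/-- The Jordan basis `(X - μ) ^ (e - 1), …, X - μ, 1` of `ℂ[X] ⧸ (X - μ) ^ e`. -/
theorem exists_basis_quotient_span_X_sub_C_pow (μ : ℂ) (e : ℕ) :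
    ∃ b : Module.Basis (Fin e) ℂ (ℂ[X] ⧸ Ideal.span {(X - C μ) ^ e}),
      ∀ j : Fin e, b j = Ideal.Quotient.mk _ ((X - C μ) ^ (e - 1 - j)) := by
  let v : Fin e → (ℂ[X] ⧸ Ideal.span {(X - C μ) ^ e}) :=
    fun j => Ideal.Quotient.mk _ ((X - C μ) ^ (e - 1 - j))
  have hfin : Module.finrank ℂ (ℂ[X] ⧸ Ideal.span {(X - C μ) ^ e}) = e := by
    rw [finrank_quotient_span_eq_natDegree, natDegree_pow, natDegree_X_sub_C, mul_one]
  have hspan : ⊤ ≤ Submodule.span ℂ (Set.range v) := by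
    rintro x -
    obtain ⟨f, rfl⟩ := Ideal.Quotient.mk_surjective x
    -- Taylor expansion at `μ`: powers of `X - μ` span, and those from `e` on vanish in the
    -- quotient.
    rw [← sum_taylor_eq f μ, Polynomial.sum, map_sum]
    refine Submodule.sum_mem _ fun i _ => ?_
    rw [← smul_eq_C_mul]
    change (Ideal.Quotient.mkₐ ℂ _) (_ • _) ∈ _
    rw [map_smul]
    refine Submodule.smul_mem _ _ ?_
    rcases lt_or_ge i e with hi | hi
    · refine Submodule.subset_span ⟨⟨e - 1 - i, by omega⟩, ?_⟩
      simp only [v, Ideal.Quotient.mkₐ_eq_mk]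
      congr 2
      omega
    · have : (Ideal.Quotient.mkₐ ℂ (Ideal.span {(X - C μ) ^ e})) ((X - C μ) ^ i) = 0 := by
        rw [Ideal.Quotient.mkₐ_eq_mk, Ideal.Quotient.eq_zero_iff_mem, Ideal.mem_span_singleton]
        exact pow_dvd_pow _ hi
      rw [this]
      exact Submodule.zero_mem _
  have hli := linearIndependent_of_top_le_span_of_card_eq_finrank hspan (by simp [hfin])
  exact ⟨Module.Basis.mk hli hspan, fun j => by simp [v]⟩

theorem Irreducible.exists_associated_X_sub_C {p : ℂ[X]} (hp : Irreducible p) :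
    ∃ μ, Associated p (X - C μ) := by
  obtain ⟨μ, hμ⟩ := IsAlgClosed.exists_root p (IsAlgClosed.degree_eq_one_of_irreducible ℂ hp ▸ one_ne_zero)
  exact ⟨μ, ((irreducible_X_sub_C μ).associated_of_dvd hp (dvd_iff_isRoot.2 hμ)).symm⟩

/-- `V` with `X` acting as `A` is a torsion module over the PID ℂ[X], hence a sum of quotients by
powers of linear polynomials. On each, X = μ + (X - μ) shifts the basis of powers of X - μ. -/
theorem nonempty_jordanDecomposition {V : Type*} [AddCommGroup V] [Module ℂ V]
    [FiniteDimensional ℂ V] (A : V →ₗ[ℂ] V) : Nonempty (JordanDecomposition A) := by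
  classical
  obtain ⟨ι, _, p, hp, e, ⟨φ⟩⟩ := Module.equiv_directSum_of_isTorsion
    (R := ℂ[X]) (M := Module.AEval' A) (Module.AEval.isTorsion_of_finiteDimensional ℂ V A)
  choose μ hμ using fun i => (hp i).exists_associated_X_sub_C
  have hspan : ∀ i, Ideal.span {p i ^ e i} = Ideal.span {(X - C (μ i)) ^ e i} := fun i =>
    Ideal.span_singleton_eq_span_singleton.2 ((hμ i).pow_pow)
  have hb : ∀ i, ∃ b : Module.Basis (Fin (e i)) ℂ (ℂ[X] ⧸ Ideal.span {p i ^ e i}),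
      ∀ j : Fin (e i), b j = Ideal.Quotient.mk _ ((X - C (μ i)) ^ (e i - 1 - j)) := by
    intro i
    rw [hspan i]
    exact exists_basis_quotient_span_X_sub_C_pow (μ i) (e i)
  choose b hb using hb
  let φ' : V ≃ₗ[ℂ] Π₀ i, ℂ[X] ⧸ Ideal.span {p i ^ e i} :=
    (Module.AEval'.of A).trans (φ.restrictScalars ℂ)
  let B := (DFinsupp.basis b).map φ'.symm
  have hX : ∀ v, φ' (A v) = (X : ℂ[X]) • φ' v := by
    intro v
    change φ (Module.AEval'.of A (A v)) = (X : ℂ[X]) • φ (Module.AEval'.of A v)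
    rw [← Module.AEval'.X_smul_of, map_smul]
  have hB : ∀ i (j : Fin (e i)), φ' (B ⟨i, j⟩) = DFinsupp.single i (b i j) := by
    intro i j
    have : DFinsupp.basis b ⟨i, j⟩ = DFinsupp.single i (b i j) := by
      apply (DFinsupp.basis b).repr.injective
      rw [Module.Basis.repr_self]
      simp only [DFinsupp.basis, LinearEquiv.trans_apply, DFinsupp.mapRange.linearEquiv_apply,
        DFinsupp.mapRange_single, Module.Basis.repr_self]
      exact ((Equiv.symm_apply_eq _).2 (sigmaFinsuppEquivDFinsupp_single (η := fun i => Fin (e i))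
        ⟨i, j⟩ (1 : ℂ)).symm).symm
    simp [B, this]
  refine nonempty_jordanDecomposition_of_basis B μ A fun i j => φ'.injective ?_
  rw [hX, map_add, map_smul, hB]
  have hdite : φ' (if _h : 0 < (j : ℕ) then B ⟨i, ⟨j - 1, (Nat.sub_le _ _).trans_lt j.2⟩⟩ else 0) =
      DFinsupp.single i (Ideal.Quotient.mk _ ((X - C (μ i)) ^ (e i - 1 - j + 1))) := by
    split_ifs with h
    · rw [hB, hb]
      congr 3
      simp only
      omega
    · rw [map_zero, eq_comm, DFinsupp.single_eq_zero, Ideal.Quotient.eq_zero_iff_mem, hspan]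
      rw [show e i - 1 - j + 1 = e i by omega]
      exact Ideal.mem_span_singleton_self _
  rw [hdite, ← DFinsupp.single_smul, ← DFinsupp.single_smul, ← DFinsupp.single_add, hb]
  congr 1
  change Ideal.Quotient.mk _ (X * _) =
    Ideal.Quotient.mkₐ ℂ _ (μ i • (X - C (μ i)) ^ (e i - 1 - j)) + _
  rw [Ideal.Quotient.mkₐ_eq_mk, ← map_add]
  congr 1
  rw [smul_eq_C_mul]
  ring

end Existence

/-! ### Diagonalising the pencil near an eigenvalue. -/

section Pencil

/-- A Jordan string `v 0, …, v (m - 1)` for the eigenvalue `lam` contains a vector, equal to `v 0`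
at `w = 0`, that `A - (lam + w)` maps to a vector of order `w ^ m`. -/
theorem map_sum_pow_smul_sub_smul {V : Type*} [AddCommGroup V] [Module ℂ V] (A : V →ₗ[ℂ] V)
    (lam w : ℂ) {m : ℕ} (hm : 0 < m) (v : ℕ → V)
    (hv : ∀ i < m, A (v i) = lam • v i + if 0 < i then v (i - 1) else 0) :
    A (∑ i ∈ Finset.range m, w ^ i • v i) - (lam + w) • ∑ i ∈ Finset.range m, w ^ i • v i =
      -(w ^ m • v (m - 1)) := by
  let F : ℕ → V := fun i => if 0 < i then w ^ i • v (i - 1) else 0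
  have h : ∀ i ∈ Finset.range m, A (w ^ i • v i) - (lam + w) • w ^ i • v i = F i - F (i + 1) := by
    intro i hi
    rw [map_smul, hv i (Finset.mem_range.1 hi)]
    simp only [F, Nat.succ_pos, if_true, Nat.add_sub_cancel]
    split_ifs
    · module
    · module
  rw [map_sum, Finset.smul_sum, ← Finset.sum_sub_distrib, Finset.sum_congr rfl h,
    Finset.sum_range_sub']
  simp [F, hm]

namespace JordanDecomposition

variable {V : Type*} [AddCommGroup V] [Module ℂ V] {A : V →ₗ[ℂ] V} (D : JordanDecomposition A)

/-- The `i`-th vector of the `k`-th Jordan string, `0` past its end. -/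
noncomputable def vec (k : Fin D.numBlocks) (i : ℕ) : V :=
  if h : i < D.size k then D.basis ⟨k, ⟨i, h⟩⟩ else 0

theorem vec_coe (k : Fin D.numBlocks) (i : Fin (D.size k)) : D.vec k i = D.basis ⟨k, i⟩ := by
  simp [vec]

theorem apply_vec (k : Fin D.numBlocks) (i : ℕ) (hi : i < D.size k) :
    A (D.vec k i) = D.eigenvalue k • D.vec k i + if 0 < i then D.vec k (i - 1) else 0 := by
  have h := D.apply_basis k ⟨i, hi⟩
  rw [← D.vec_coe] at h
  rw [h]
  congr 1
  split_ifs with h0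
  · rw [← D.vec_coe]
  · rfl

/-- The exponents of the orders of the singular values of `A - (lam + w)` as `w → 0`: the size of
the block for the first vector of each block with eigenvalue `lam`, and `0` otherwise. -/
noncomputable def order (lam : ℂ) (x : Σ k : Fin D.numBlocks, Fin (D.size k)) : ℕ :=
  open Classical in if D.eigenvalue x.1 = lam ∧ (x.2 : ℕ) = 0 then D.size x.1 else 0

theorem exists_order_eq_iff (lam : ℂ) {l : ℕ} (hl : 1 ≤ l) :
    (∃ x, D.order lam x = l) ↔ ∃ k, D.size k = l ∧ D.eigenvalue k = lam := by
  constructor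
  · rintro ⟨x, hx⟩
    unfold order at hx
    split_ifs at hx with h
    · exact ⟨x.1, hx, h.1⟩
    · omega
  · rintro ⟨k, hk, hk'⟩
    exact ⟨⟨k, ⟨0, D.size_pos k⟩⟩, by simp [order, hk, hk']⟩

variable {E : Type*} [AddCommGroup E] [Module ℂ E] (B : V ≃ₗ[ℂ] E)

/-- Input vectors bringing the pencil to diagonal form near `lam`. -/
noncomputable def inputVec (lam w : ℂ) (x : Σ k : Fin D.numBlocks, Fin (D.size k)) : V :=
  open Classical in if D.eigenvalue x.1 = lam ∧ (x.2 : ℕ) = 0 then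
    ∑ i ∈ Finset.range (D.size x.1), w ^ i • D.vec x.1 i
  else D.vec x.1 x.2

/-- Output vectors bringing the pencil to diagonal form near `lam`. -/
noncomputable def outputVec (lam w : ℂ) (x : Σ k : Fin D.numBlocks, Fin (D.size k)) : E :=
  open Classical in if D.eigenvalue x.1 = lam ∧ (x.2 : ℕ) = 0 then
    -B (D.vec x.1 (D.size x.1 - 1))
  else B (A (D.vec x.1 x.2)) - (lam + w) • B (D.vec x.1 x.2)

theorem map_inputVec (lam w : ℂ) (x : Σ k : Fin D.numBlocks, Fin (D.size k)) :
    B (A (D.inputVec lam w x)) - (lam + w) • B (D.inputVec lam w x) =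
      w ^ D.order lam x • D.outputVec B lam w x := by
  unfold inputVec outputVec order
  split_ifs with h
  · rw [← map_smul, ← map_sub, map_sum_pow_smul_sub_smul A lam w (D.size_pos x.1) (D.vec x.1)
      (fun i hi => by rw [D.apply_vec _ _ hi, h.1])]
    simp
  · simp

theorem inputVec_zero (lam : ℂ) : D.inputVec lam 0 = D.basis := by
  funext x
  obtain ⟨k, j⟩ := x
  rw [← D.vec_coe, inputVec]
  split_ifs with h
  · simp only at h ⊢
    rw [Finset.sum_eq_single_of_mem 0 (Finset.mem_range.2 (D.size_pos k))
      (fun i _ hi => by simp [hi]), h.2]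
    simp
  · rfl

/-- In a `lam`-block the outputs at `w = 0` are, up to sign, the images under `B` of the string,
cyclically shifted. In any other block A - lam is triangular with nonzero diagonal, so induction
along the string recovers each vector. -/
theorem map_vec_mem_span_outputVec (lam : ℂ) (k : Fin D.numBlocks) (i : ℕ) (hi : i < D.size k) :
    B (D.vec k i) ∈ Submodule.span ℂ (Set.range (D.outputVec B lam 0)) := by
  by_cases hk : D.eigenvalue k = lam
  · by_cases hi' : i + 1 < D.size k
    · refine Submodule.subset_span ⟨⟨k, ⟨i + 1, hi'⟩⟩, ?_⟩
      simp [outputVec, D.apply_vec k _ hi', hk]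
    · rw [← neg_neg (B (D.vec k i))]
      refine Submodule.neg_mem _ (Submodule.subset_span ⟨⟨k, ⟨0, D.size_pos k⟩⟩, ?_⟩)
      have : D.size k - 1 = i := by omega
      simp [outputVec, hk, this]
  · have key : ∀ i < D.size k, (D.eigenvalue k - lam) • B (D.vec k i) +
        (if 0 < i then B (D.vec k (i - 1)) else 0) ∈
          Submodule.span ℂ (Set.range (D.outputVec B lam 0)) := by
      intro i hi
      refine Submodule.subset_span ⟨⟨k, ⟨i, hi⟩⟩, ?_⟩
      simp only [outputVec, hk, false_and, if_false, D.apply_vec k _ hi, map_add, map_smul,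
        apply_ite B, map_zero]
      module
    induction i with
    | zero =>
      have h := key 0 hi
      rw [if_neg (lt_irrefl 0), add_zero] at h
      exact (Submodule.smul_mem_iff _ (sub_ne_zero.2 hk)).1 h
    | succ i ih =>
      have h := key (i + 1) hi
      rw [if_pos i.succ_pos, Nat.add_sub_cancel] at h
      exact (Submodule.smul_mem_iff _ (sub_ne_zero.2 hk)).1
        ((Submodule.add_mem_iff_left _ (ih (by omega))).1 h)

theorem linearIndependent_outputVec_zero (lam : ℂ) :
    LinearIndependent ℂ (D.outputVec B lam 0) := by
  refine linearIndependent_of_top_le_span_of_card_eq_finrank ?_ ?_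
  · rw [← (D.basis.map B).span_eq, Submodule.span_le]
    rintro _ ⟨⟨k, j⟩, rfl⟩
    rw [Module.Basis.map_apply, ← D.vec_coe]
    exact D.map_vec_mem_span_outputVec B lam k j j.2
  · rw [← B.finrank_eq, Module.finrank_eq_card_basis D.basis]

end JordanDecomposition

variable {X E : Type*}
  [NormedAddCommGroup X] [InnerProductSpace ℂ X] [FiniteDimensional ℂ X]
  [NormedAddCommGroup E] [InnerProductSpace ℂ E] [FiniteDimensional ℂ E]

theorem JordanDecomposition.singularValues_pencil_isTheta {K : X →ₗ[ℂ] E} {B : X ≃ₗ[ℂ] E}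
    (D : JordanDecomposition (B.symm.toLinearMap ∘ₗ K)) (lam : ℂ) {j m : ℕ}
    (hj : (Finset.univ.filter fun i => D.order lam i < m).card ≤ j)
    (hj' : j < (Finset.univ.filter fun i => D.order lam i ≤ m).card) :
    (fun w : ℂ => (pencil K B.toLinearMap (lam + w)).singularValues j) =Θ[𝓝 0]
      fun w => ‖w‖ ^ m := by
  refine singularValues_isTheta_norm_pow (fun w => pencil K B.toLinearMap (lam + w))
    (D.inputVec lam) (D.outputVec B lam) (D.order lam) ?_ ?_ ?_ ?_
    (D.linearIndependent_outputVec_zero B lam) ?_ hj hj'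
  · intro w x
    rw [← D.map_inputVec]
    simp [pencil]
  · intro x
    unfold JordanDecomposition.inputVec
    split_ifs <;> fun_prop
  · intro x
    unfold JordanDecomposition.outputVec
    split_ifs <;> fun_prop
  · rw [D.inputVec_zero]
    exact D.basis.linearIndependent
  · rw [Module.finrank_eq_card_basis D.basis]

theorem JordanDecomposition.singularValues_pencil_ray_isTheta {K : X →ₗ[ℂ] E} {B : X ≃ₗ[ℂ] E}
    (D : JordanDecomposition (B.symm.toLinearMap ∘ₗ K)) (lam : ℂ) (θ : ℝ) {j m : ℕ}
    (hj : (Finset.univ.filter fun i => D.order lam i < m).card ≤ j)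
    (hj' : j < (Finset.univ.filter fun i => D.order lam i ≤ m).card) :
    (fun ε : ℝ => (pencil K B.toLinearMap
      (lam + (ε : ℂ) * Complex.exp (θ * Complex.I))).singularValues j) =Θ[𝓝 0]
        fun ε : ℝ => |ε| ^ m := by
  have ht : Filter.Tendsto (fun ε : ℝ => (ε : ℂ) * Complex.exp (θ * Complex.I)) (𝓝 0) (𝓝 0) := by
    have : Continuous fun ε : ℝ => (ε : ℂ) * Complex.exp (θ * Complex.I) := by fun_prop
    simpa using this.tendsto 0
  have h := D.singularValues_pencil_isTheta lam hj hj'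
  have h' := And.intro (h.1.comp_tendsto ht) (h.2.comp_tendsto ht)
  simpa [Function.comp_def, Complex.norm_exp_ofReal_mul_I, Asymptotics.IsTheta] using h'

end Pencil

theorem theorem6 {X E : Type*}
    [NormedAddCommGroup X] [InnerProductSpace ℂ X] [FiniteDimensional ℂ X]
    [NormedAddCommGroup E] [InnerProductSpace ℂ E] [FiniteDimensional ℂ E]
    (K : X →ₗ[ℂ] E) (B : X ≃ₗ[ℂ] E)
    (lam : ℂ) (hlam : Module.End.HasEigenvalue (B.symm.toLinearMap ∘ₗ K) lam)
    (θ : ℝ) (l : ℕ) (hl : 1 ≤ l) :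
    (∃ j : Fin (Module.finrank ℂ X),
      (fun ε : ℝ =>
        (pencil K B.toLinearMap (lam + (ε : ℂ) * Complex.exp (θ * Complex.I))).singularValues j)
        =Θ[𝓝 0] fun ε : ℝ => |ε| ^ l) ↔
      HasJordanBlock (B.symm.toLinearMap ∘ₗ K) l lam := by
  classical
  constructor
  · rintro ⟨j, hj⟩
    obtain ⟨D⟩ := nonempty_jordanDecomposition (B.symm.toLinearMap ∘ₗ K)
    obtain ⟨m, hm, hm'⟩ := exists_card_filter_lt_le_and_lt_card_filter_le (D.order lam) (j := j)
      (by rw [← Module.finrank_eq_card_basis D.basis]; exact j.2)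
    have h := (D.singularValues_pencil_ray_isTheta lam θ hm hm').symm.trans hj
    have hml : m = l := eq_of_norm_pow_isTheta_norm_pow (by simpa [Real.norm_eq_abs] using h)
    subst hml
    refine ⟨D, (D.exists_order_eq_iff lam hl).1 ?_⟩
    by_contra! hne
    -- If no exponent equals `m`, the conditions `< m` and `≤ m` select the same indices, leaving no
    -- room for `j` between the two counts.
    refine absurd (hm.trans_lt hm') (not_lt.2 (Finset.card_le_card fun x hx => ?_))
    have := hne x
    simp only [Finset.mem_filter, Finset.mem_univ, true_and] at hx ⊢
    omega
  · rintro ⟨D, hD⟩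
    obtain ⟨x, hx⟩ := (D.exists_order_eq_iff lam hl).2 hD
    have hlt : (Finset.univ.filter fun i => D.order lam i < l).card <
        (Finset.univ.filter fun i => D.order lam i ≤ l).card := by
      refine Finset.card_lt_card (Finset.ssubset_iff_of_subset ?_ |>.2 ⟨x, ?_, ?_⟩)
      · intro y hy
        simp only [Finset.mem_filter, Finset.mem_univ, true_and] at hy ⊢
        omega
      · simp [hx]
      · simp [hx]
    -- The witness is the number of exponents below `l`: the first position, counted from 0, holding
    -- the exponent `l`.
    refine ⟨⟨_, hlt.trans_le ?_⟩, D.singularValues_pencil_ray_isTheta lam θ le_rfl hlt⟩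
    rw [Module.finrank_eq_card_basis D.basis]
    exact Finset.card_le_univ _
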